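/- Let $K_{2,2}$ be the complete bipartite graph with both parts of size $2$ (the $4$-cycle), and call a graph $F$-free if it does not contain $F$ as a (not necessarily induced) subgraph. Write $\mathrm{ex}(n,F)$ for the maximum number of edges of an $F$-free graph on $n$ vertices. A real number $\alpha$ is the exponent of $F$ if there are constants $c_1,c_2>0$ such that $c_1n^{\alpha}\le \mathrm{ex}(n,F)\le c_2n^{\alpha}$ for all sufficiently large $n$ (there is at most one such $\alpha$). For a graph $F$ with exponent $\alpha$, the infinite Turán number of $F$ is \[ \mathrm{ex}(\infty,F):=\sup_{G}\ \liminf_{n\to\infty}\frac{e(G_n)}{n^{\alpha}}, \] where the supremum is over all $F$-free graphs $G$ with vertex set $\mathbb{N}=\{1,2,3,\dots\}$, $G_n$ is the subgraph of $G$ induced by $\{1,\dots,n\}$, and $e(G_n)$ is its number of edges. Theorem. The graph $K_{2,2}$ has exponent $3/2$, and its infinite Turán number satisfies \[ \mathrm{ex}(\infty,K_{2,2})\le 0.41 . \] -/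

import Mathlib

/-- `α` is an exponent of the graph `F`: there are positive constants `c₁`, `c₂` such that
`c₁ n ^ α ≤ ex(n, F) ≤ c₂ n ^ α` for all sufficiently large `n`. -/
def IsTuranExponent {W : Type*} (F : SimpleGraph W) (α : ℝ) : Prop :=
  ∃ c₁ c₂ : ℝ, 0 < c₁ ∧ 0 < c₂ ∧ ∀ᶠ n : ℕ in Filter.atTop,
    c₁ * (n : ℝ) ^ α ≤ (SimpleGraph.extremalNumber n F : ℝ) ∧
      (SimpleGraph.extremalNumber n F : ℝ) ≤ c₂ * (n : ℝ) ^ α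

theorem IsTuranExponent.le {W : Type*} {F : SimpleGraph W} {α β : ℝ}
    (hα : IsTuranExponent F α) (hβ : IsTuranExponent F β) : β ≤ α := by
  obtain ⟨_, c₂, _, _, h⟩ := hα
  obtain ⟨d₁, _, hd₁, _, h'⟩ := hβ
  by_contra! hlt
  have ht : Filter.Tendsto (fun n : ℕ => (n : ℝ) ^ (β - α)) Filter.atTop Filter.atTop :=
    (tendsto_rpow_atTop (sub_pos.2 hlt)).comp tendsto_natCast_atTop_atTop
  obtain ⟨n, h1, h2, h3, hn⟩ :=
    (h.and (h'.and ((ht.eventually_gt_atTop (c₂ / d₁)).and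
      (Filter.eventually_gt_atTop 0)))).exists
  have hn' : (0 : ℝ) < n := by exact_mod_cast hn
  have hp : (0 : ℝ) < (n : ℝ) ^ α := Real.rpow_pos_of_pos hn' α
  have hle := h2.1.trans h1.2
  have heq : (n : ℝ) ^ β = (n : ℝ) ^ (β - α) * (n : ℝ) ^ α := by
    rw [← Real.rpow_add hn', sub_add_cancel]
  rw [heq, ← mul_assoc] at hle
  have h4 := le_of_mul_le_mul_right hle hp
  rw [div_lt_iff₀ hd₁] at h3
  linarith

/-- A graph has at most one exponent. -/
theorem IsTuranExponent.unique {W : Type*} {F : SimpleGraph W} {α β : ℝ}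
    (hα : IsTuranExponent F α) (hβ : IsTuranExponent F β) : α = β :=
  le_antisymm (hβ.le hα) (hα.le hβ)

/-- The exponent of `F` (only meaningful if `F` has one; it is then unique). -/
noncomputable def turanExponent {W : Type*} (F : SimpleGraph W) : ℝ :=
  Classical.epsilon (IsTuranExponent F)

theorem IsTuranExponent.turanExponent_eq {W : Type*} {F : SimpleGraph W} {α : ℝ}
    (hα : IsTuranExponent F α) : turanExponent F = α :=
  IsTuranExponent.unique (Classical.epsilon_spec (p := IsTuranExponent F) ⟨α, hα⟩) hα

/-- `e(G_n)`: the number of edges of the subgraph of `G` induced by its first `n` vertices.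
The vertices are numbered `0, 1, 2, …` here, so these are `0, …, n - 1`. -/
noncomputable def initialEdges (G : SimpleGraph ℕ) (n : ℕ) : ℕ :=
  (G.induce (Set.Iio n)).edgeSet.ncard

/-- The infinite Turán number `ex(∞, F)`: the supremum, over all `F`-free graphs `G` with
vertex set `ℕ`, of `liminf e(G_n) / n ^ α`, where `α` is the exponent of `F`.  The limit inferior
and the supremum are taken in the extended reals. -/
noncomputable def infiniteTuranNumber {W : Type*} (F : SimpleGraph W) : EReal :=
  ⨆ G : {G : SimpleGraph ℕ // F.Free G},
    Filter.liminf
      (fun n : ℕ => (((initialEdges G.1 n : ℝ) / (n : ℝ) ^ turanExponent F : ℝ) : EReal))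
      Filter.atTop

/-! In a $K_{2,2}$-free graph a pair of vertices in $X$ has at most one common neighbour, so the
squared degrees into $X$ sum to roughly at most $|X|^2$ (`two_mul_sum_mul_card_le`). Taking all
vertices as $X$ gives the upper bound for the exponent; polarity graphs give the lower one.

For the infinite bound, cut $\mathbb{N}$ at the powers of $4$ and average $8^{-l}e(G_{4^l})$ over
$l$. An edge whose later end lies in block $j$ is counted for every $l\ge j$, with total at most
$\frac87 8^{-j}$, and `blockWeight` shares this charge between its two ends (`sum_initialEdges_le`).
The charge at block $i$ is a weighted sum of degrees into that block, so the count of pairs bounds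
it by $0.4095+O(2^{-i})$ (`weightedBlockDegree_add_six_le`). The averages then cannot stay above
$0.41$. -/

open Finset SimpleGraph

/-! ### Counting pairs with a common neighbour. -/

section CherryCounting

variable {V : Type*} {G : SimpleGraph V}

theorem completeBipartiteGraph_two_two_free_iff :
    (completeBipartiteGraph (Fin 2) (Fin 2)).Free G ↔
      ∀ ⦃x y z w : V⦄, x ≠ y → z ≠ w → G.Adj z x → G.Adj z y → G.Adj w x → ¬ G.Adj w y := by
  constructor
  · intro h x y z w hxy hzw hzx hzy hwx hwy
    refine h ⟨⟨⟨Sum.elim ![x, y] ![z, w], ?_⟩, ?_⟩⟩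
    · rintro (i | i) (j | j) hij <;> fin_cases i <;> fin_cases j <;>
        simp_all [G.adj_comm]
    · have h1 := hzx.ne
      have h2 := hzy.ne
      have h3 := hwx.ne
      have h4 := hwy.ne
      rintro (i | i) (j | j) hij <;> fin_cases i <;> fin_cases j <;> simp_all [eq_comm]
  · rintro h ⟨f⟩
    have hadj (i j : Fin 2) : G.Adj (f (Sum.inr i)) (f (Sum.inl j)) :=
      f.toHom.map_adj (by simp)
    refine h (x := f (Sum.inl 0)) (y := f (Sum.inl 1)) (z := f (Sum.inr 0))
      (w := f (Sum.inr 1)) ?_ ?_ (hadj _ _) (hadj _ _) (hadj _ _) (hadj _ _)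
    · exact f.injective.ne (by simp)
    · exact f.injective.ne (by simp)

variable [DecidableEq V] [DecidableRel G.Adj]

/-- In a `K_{2,2}`-free graph the neighbourhoods inside `X` of distinct vertices share no pair. -/
theorem sum_card_offDiag_le (hG : (completeBipartiteGraph (Fin 2) (Fin 2)).Free G)
    (X Z : Finset V) :
    ∑ z ∈ Z, #(X.filter (G.Adj z)).offDiag ≤ #X.offDiag := by
  rw [completeBipartiteGraph_two_two_free_iff] at hG
  rw [← card_biUnion]
  · refine card_le_card fun p hp ↦ ?_
    simp only [mem_biUnion, mem_offDiag, mem_filter] at hp ⊢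
    obtain ⟨z, -, h1, h2, h3⟩ := hp
    exact ⟨h1.1, h2.1, h3⟩
  · intro z _ w _ hzw
    refine disjoint_left.2 fun p hp hq ↦ ?_
    simp only [mem_offDiag, mem_filter] at hp hq
    exact hG hp.2.2 hzw hp.1.2 hp.2.1.2 hq.1.2 hq.2.1.2

/-- Cauchy–Schwarz with free multipliers: $(d-s-\frac12)^2\ge 0$ turns $2sd$ into $d(d-1)$, the
ordered pairs at $z$, plus $(s+\frac12)^2$. -/
theorem two_mul_sum_mul_card_le (hG : (completeBipartiteGraph (Fin 2) (Fin 2)).Free G)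
    (X Z : Finset V) (s : V → ℝ) :
    2 * ∑ z ∈ Z, s z * #(X.filter (G.Adj z)) ≤ (#X : ℝ) ^ 2 + ∑ z ∈ Z, (s z + 1 / 2) ^ 2 := by
  have hcast (Y : Finset V) : (#Y.offDiag : ℝ) = (#Y : ℝ) ^ 2 - #Y := by
    rw [offDiag_card, Nat.cast_sub (Nat.le_mul_self _)]
    push_cast
    ring
  have h : ((∑ z ∈ Z, #(X.filter (G.Adj z)).offDiag : ℕ) : ℝ) ≤ (#X.offDiag : ℕ) := by
    exact_mod_cast sum_card_offDiag_le hG X Z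
  push_cast [hcast] at h
  calc 2 * ∑ z ∈ Z, s z * #(X.filter (G.Adj z))
      = ∑ z ∈ Z, 2 * (s z * #(X.filter (G.Adj z))) := mul_sum ..
    _ ≤ ∑ z ∈ Z, (((#(X.filter (G.Adj z)) : ℝ) ^ 2 - #(X.filter (G.Adj z))) +
          (s z + 1 / 2) ^ 2) := by
        refine sum_le_sum fun z _ ↦ ?_
        nlinarith [sq_nonneg ((#(X.filter (G.Adj z)) : ℝ) - s z - 1 / 2)]
    _ ≤ _ := by
        rw [sum_add_distrib]
        have : (0 : ℝ) ≤ #X := by positivity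
        linarith

end CherryCounting

/-! ### The exponent $3/2$. -/

section Exponent

theorem extremalNumber_two_two_le (n : ℕ) :
    (extremalNumber n (completeBipartiteGraph (Fin 2) (Fin 2)) : ℝ) ≤
      1 * (n : ℝ) ^ (3 / 2 : ℝ) := by
  classical
  rcases n.eq_zero_or_pos with rfl | hn
  · have h : extremalNumber (Fintype.card (Fin 0))
        (completeBipartiteGraph (Fin 2) (Fin 2)) ≤ 0 := by
      rw [extremalNumber_le_iff]
      intro G _ _
      simp [Subsingleton.elim G ⊥]
    simp only [Fintype.card_fin, nonpos_iff_eq_zero] at h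
    simp [h]
  have hpos : (0 : ℝ) ≤ 1 * (n : ℝ) ^ (3 / 2 : ℝ) := by positivity
  have key := extremalNumber_le_iff_of_nonneg (V := Fin n)
    (completeBipartiteGraph (Fin 2) (Fin 2)) hpos
  rw [Fintype.card_fin] at key
  rw [key]
  intro G _ hG
  have h := two_mul_sum_mul_card_le hG univ univ (fun _ ↦ √(n : ℝ))
  have hdeg : ∑ z : Fin n, (#(univ.filter (G.Adj z)) : ℝ) = 2 * #G.edgeFinset := by
    have := G.sum_degrees_eq_twice_card_edges
    simp only [← card_neighborFinset_eq_degree, neighborFinset_eq_filter] at this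
    exact_mod_cast this
  rw [← mul_sum, hdeg] at h
  simp only [sum_const, card_univ, Fintype.card_fin, nsmul_eq_mul] at h
  have hn' : (1 : ℝ) ≤ n := by exact_mod_cast hn
  have hs : (1 : ℝ) ≤ √n := Real.one_le_sqrt.2 hn'
  have hss : √(n : ℝ) * √n = n := Real.mul_self_sqrt (by positivity)
  have hpow : (n : ℝ) ^ (3 / 2 : ℝ) = n * √n := by
    rw [Real.sqrt_eq_rpow, ← Real.rpow_one_add' (by positivity) (by norm_num)]
    norm_num
  rw [hpow, one_mul]
  have hbound : (n : ℝ) ^ 2 + n * (√n + 1 / 2) ^ 2 ≤ 4 * √n * (n * √n) := by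
    have h1 : √(n : ℝ) ≤ n := by nlinarith
    have h2 : 4 * √(n : ℝ) * (n * √n) = 4 * n * n := by linear_combination 4 * (n : ℝ) * hss
    have h3 : (√(n : ℝ) + 1 / 2) ^ 2 = n + √n + 1 / 4 := by linear_combination hss
    rw [h2, h3]
    nlinarith
  have : 4 * √(n : ℝ) * #G.edgeFinset ≤ 4 * √n * (n * √n) := by linarith
  exact le_of_mul_le_mul_left this (by positivity)

/-- The polarity graph of the affine plane over `R`, with loops removed: `(a, b)` and `(c, d)` are
adjacent when `a * c = b + d`. -/
def affinePolarityGraph (R : Type*) [CommRing R] : SimpleGraph (R × R) where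
  Adj u v := u ≠ v ∧ u.1 * v.1 = u.2 + v.2
  symm := ⟨fun u v h ↦ ⟨h.1.symm, by rw [mul_comm, h.2, add_comm]⟩⟩
  loopless := ⟨fun _ h ↦ h.1 rfl⟩

theorem affinePolarityGraph_free (K : Type*) [Field K] :
    (completeBipartiteGraph (Fin 2) (Fin 2)).Free (affinePolarityGraph K) := by
  rw [completeBipartiteGraph_two_two_free_iff]
  rintro ⟨a, b⟩ ⟨c, d⟩ ⟨e, f⟩ ⟨g, h⟩ hxy hzw ⟨-, h1⟩ ⟨-, h2⟩ ⟨-, h3⟩ ⟨-, h4⟩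
  simp only at h1 h2 h3 h4
  -- The alternating sum of the four equations cancels the second coordinates.
  have hprod : (e - g) * (a - c) = 0 := by linear_combination h1 - h2 - h3 + h4
  rcases mul_eq_zero.1 hprod with h0 | h0
  · rw [sub_eq_zero] at h0
    subst h0
    exact hzw (Prod.ext rfl (by simpa using h1.symm.trans h3))
  · rw [sub_eq_zero] at h0
    subst h0
    exact hxy (Prod.ext rfl (by simpa using h1.symm.trans h2))

open scoped Classical in
theorem le_two_mul_card_edgeFinset_affinePolarityGraph (K : Type*) [Field K] [Fintype K] :
    Fintype.card K ^ 2 * (Fintype.card K - 1) ≤ 2 * #(affinePolarityGraph K).edgeFinset := by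
  rw [← sum_degrees_eq_twice_card_edges, sq, ← Fintype.card_prod, ← smul_eq_mul, ← card_univ]
  refine card_nsmul_le_sum _ _ _ fun u _ ↦ ?_
  rw [← card_neighborFinset_eq_degree]
  have hinj : Function.Injective fun c : K ↦ (c, u.1 * c - u.2) := fun c d h ↦ congrArg Prod.fst h
  -- Each first coordinate gives one solution; only the loop at `u` can be lost.
  have hsub : ((univ.image fun c : K ↦ (c, u.1 * c - u.2)).erase u) ⊆
      (affinePolarityGraph K).neighborFinset u := by
    intro v hv
    simp only [mem_erase, mem_image, mem_univ, true_and] at hv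
    obtain ⟨hne, c, rfl⟩ := hv
    rw [mem_neighborFinset]
    exact ⟨hne.symm, by ring⟩
  refine le_trans ?_ (card_le_card hsub)
  refine le_trans ?_ pred_card_le_card_erase
  rw [card_image_of_injective _ hinj, card_univ]

theorem le_extremalNumber_two_two {n p : ℕ} (hp : p.Prime) (h : p ^ 2 ≤ n) :
    p ^ 2 * (p - 1) ≤ 2 * extremalNumber n (completeBipartiteGraph (Fin 2) (Fin 2)) := by
  classical
  have := Fact.mk hp
  have hcard : Fintype.card (ZMod p × ZMod p) ≤ Fintype.card (Fin n) := by
    simpa [ZMod.card, ← sq] using h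
  obtain ⟨f⟩ := Function.Embedding.nonempty_of_card_le hcard
  have hfree : (completeBipartiteGraph (Fin 2) (Fin 2)).Free
      ((affinePolarityGraph (ZMod p)).map f) := by
    have h0 := affinePolarityGraph_free (ZMod p)
    rw [completeBipartiteGraph_two_two_free_iff] at h0 ⊢
    rintro x y z w hxy hzw ⟨-, z, x, h1, rfl, rfl⟩ ⟨-, z', y, h2, hz, rfl⟩ ⟨-, w, x', h3, rfl, hx⟩
      ⟨-, w', y', h4, hw, hy⟩
    obtain rfl := f.injective hz
    obtain rfl := f.injective hx
    obtain rfl := f.injective hy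
    obtain rfl := f.injective hw
    exact h0 (fun e ↦ hxy (congrArg f e)) (fun e ↦ hzw (congrArg f e)) h1 h2 h3 h4
  have h1 := card_edgeFinset_le_extremalNumber hfree
  have h2 := le_two_mul_card_edgeFinset_affinePolarityGraph (ZMod p)
  rw [ZMod.card] at h2
  rw [Fintype.card_fin] at h1
  have h3 := SimpleGraph.card_edgeFinset_map f (affinePolarityGraph (ZMod p))
  refine h2.trans (Nat.mul_le_mul_left 2 (le_trans (le_of_eq ?_) h1))
  convert h3.symm

theorem isTuranExponent_two_two :
    IsTuranExponent (completeBipartiteGraph (Fin 2) (Fin 2)) (3 / 2) := by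
  refine ⟨1 / 32, 1, by norm_num, by norm_num, ?_⟩
  filter_upwards [Filter.eventually_ge_atTop 4] with n hn
  refine ⟨?_, extremalNumber_two_two_le n⟩
  set m := Nat.sqrt n with hm
  have hm2 : 2 ≤ m := Nat.le_sqrt.2 (by omega)
  -- Bertrand's postulate gives $p\le\sqrt n\le 2p$; then $n^{3/2}\le 8p^3\le 32\,\mathrm{ex}$.
  obtain ⟨p, hp, hp1, hp2⟩ := Nat.exists_prime_lt_and_le_two_mul (m / 2) (by omega)
  have hpm : p ≤ m := by omega
  have hpn : p ^ 2 ≤ n := by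
    have := Nat.sqrt_le' n
    exact (Nat.pow_le_pow_left hpm 2).trans this
  have hle := le_extremalNumber_two_two hp hpn
  have hnp : n ≤ (2 * p) ^ 2 := by
    have h1 : n < (m + 1) ^ 2 := Nat.lt_succ_sqrt' n
    have h2 : m + 1 ≤ 2 * p := by omega
    exact h1.le.trans (Nat.pow_le_pow_left h2 2)
  have hp1' : p ≤ 2 * (p - 1) := by have := hp.two_le; omega
  have hle' : p ^ 3 ≤ 4 * extremalNumber n (completeBipartiteGraph (Fin 2) (Fin 2)) := by
    calc p ^ 3 = p ^ 2 * p := by ring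
      _ ≤ p ^ 2 * (2 * (p - 1)) := Nat.mul_le_mul_left _ hp1'
      _ = 2 * (p ^ 2 * (p - 1)) := by ring
      _ ≤ _ := by omega
  have hle'' : (p : ℝ) ^ 3 ≤
      4 * (extremalNumber n (completeBipartiteGraph (Fin 2) (Fin 2)) : ℝ) := by
    exact_mod_cast hle'
  have hpow : (n : ℝ) ^ (3 / 2 : ℝ) ≤ (2 * (p : ℝ)) ^ 3 := by
    calc (n : ℝ) ^ (3 / 2 : ℝ) ≤ ((2 * (p : ℝ)) ^ 2) ^ (3 / 2 : ℝ) :=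
          Real.rpow_le_rpow (by positivity) (by exact_mod_cast hnp) (by norm_num)
      _ = (2 * (p : ℝ)) ^ 3 := by
          rw [← Real.rpow_natCast, ← Real.rpow_mul (by positivity), ← Real.rpow_natCast]
          norm_num
  have : (2 * (p : ℝ)) ^ 3 = 8 * (p : ℝ) ^ 3 := by ring
  linarith

end Exponent

/-! ### Blocks of ratio $4$ and the weights. -/

section Blocks

/-- The index of the block containing `v`, where the blocks are `{0}` and the intervals
`[4 ^ i, 4 ^ (i + 1))`, numbered from `0`. -/
def blockIndex (v : ℕ) : ℕ := Nat.clog 4 (v + 1)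

theorem blockIndex_le_iff {v i : ℕ} : blockIndex v ≤ i ↔ v < 4 ^ i := by
  rw [blockIndex, Nat.clog_le_iff_le_pow (by norm_num), Nat.succ_le_iff]

theorem blockIndex_eq_succ_iff {v i : ℕ} :
    blockIndex v = i + 1 ↔ 4 ^ i ≤ v ∧ v < 4 ^ (i + 1) := by
  have h1 := @blockIndex_le_iff v i
  have h2 := @blockIndex_le_iff v (i + 1)
  omega

/-- The `i`-th block. -/
def block (i : ℕ) : Finset ℕ := {v ∈ range (4 ^ i) | blockIndex v = i}

theorem mem_block {i v : ℕ} : v ∈ block i ↔ blockIndex v = i := by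
  simp only [block, mem_filter, mem_range, and_iff_right_iff_imp]
  exact fun h ↦ blockIndex_le_iff.1 h.le

theorem block_succ (i : ℕ) : block (i + 1) = Ico (4 ^ i) (4 ^ (i + 1)) := by
  ext v
  rw [mem_block, blockIndex_eq_succ_iff, mem_Ico]

theorem card_block_succ (i : ℕ) : #(block (i + 1)) = 3 * 4 ^ i := by
  rw [block_succ, Nat.card_Ico, pow_succ]
  omega

theorem sum_range_blockIndex (f : ℕ → ℝ) (k n : ℕ) :
    ∑ z ∈ range (4 ^ (k + n)), f (blockIndex z) =
      ∑ z ∈ range (4 ^ k), f (blockIndex z) +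
        ∑ m ∈ range n, 3 * 4 ^ (k + m) * f (k + m + 1) := by
  induction n with
  | zero => simp
  | succ n ih =>
    rw [sum_range_succ _ n, ← add_assoc, ← add_assoc, ← ih,
      ← sum_range_add_sum_Ico _ (Nat.pow_le_pow_right (by norm_num : 0 < 4) (Nat.le_succ (k + n))),
      ← block_succ,
      sum_congr (s₁ := block _) rfl fun z hz ↦ congrArg f (mem_block.1 hz), sum_const,
      card_block_succ, nsmul_eq_mul]
    push_cast
    rfl

/-- The weight that vertices of block `j` carry in the cherry count for block `i`. -/
noncomputable def blockWeight (i j : ℕ) : ℝ :=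
  if i ≤ j then
    -- At distance $d\le5$ the two weights $u,v$ minimise $4^du^2+4^{-d}v^2$ subject to
    -- $u+8^{-d}v=\frac87 8^{-d}$. Beyond that the later block carries the whole charge, which keeps
    -- each count finite.
    if j ≤ i + 5 then 8 / 7 / (8 ^ (j - i) + 2 ^ (j - i)) else 0
  else
    if i ≤ j + 5 then 8 / 7 / (4 ^ (i - j) + 1) else 8 / 7

theorem blockWeight_nonneg (i j : ℕ) : 0 ≤ blockWeight i j := by
  unfold blockWeight
  split_ifs <;> positivity

theorem blockWeight_le (i j : ℕ) : blockWeight i j ≤ 8 / 7 := by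
  unfold blockWeight
  split_ifs
  · exact div_le_self (by norm_num) (by
      have : (1 : ℝ) ≤ 8 ^ (j - i) := one_le_pow₀ (by norm_num)
      have : (0 : ℝ) ≤ 2 ^ (j - i) := by positivity
      linarith)
  · norm_num
  · exact div_le_self (by norm_num) (by
      have : (0 : ℝ) ≤ 4 ^ (i - j) := by positivity
      linarith)
  · rfl

theorem blockWeight_eq_zero {i j : ℕ} (h : i + 5 < j) : blockWeight i j = 0 := by
  rw [blockWeight, if_pos (by omega), if_neg (by omega)]

theorem blockWeight_add_blockWeight {i j : ℕ} (h : i ≤ j) :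
    blockWeight i j * (1 / 8) ^ i + blockWeight j i * (1 / 8) ^ j = 8 / 7 * (1 / 8) ^ j := by
  obtain ⟨d, rfl⟩ := Nat.exists_eq_add_of_le h
  have hp : (0 : ℝ) < (1 / 8) ^ i := by positivity
  rw [pow_add]
  suffices blockWeight i (i + d) + blockWeight (i + d) i * (1 / 8) ^ d = 8 / 7 * (1 / 8) ^ d by
    linear_combination (1 / 8) ^ i * this
  by_cases hd : d ≤ 5
  · interval_cases d <;> norm_num [blockWeight]
  · rw [blockWeight_eq_zero (by omega), blockWeight, if_neg (by omega), if_neg (by omega)]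
    ring

theorem blockWeight_symm_sum (i j : ℕ) :
    blockWeight i j * (1 / 8) ^ i + blockWeight j i * (1 / 8) ^ j =
      8 / 7 * (1 / 8) ^ max i j := by
  rcases le_total i j with h | h
  · rw [max_eq_right h, blockWeight_add_blockWeight h]
  · rw [max_eq_left h, add_comm, blockWeight_add_blockWeight h]

/-- The weights depend only on $i-j$: eleven blocks are evaluated numerically at $i=6$, and the
vertices below $4^k$ get the trivial bound. -/
theorem sum_sq_blockWeight_le (k : ℕ) :
    ∑ z ∈ range (4 ^ (k + 11)), blockWeight (k + 6) (blockIndex z) ^ 2 ≤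
      0.2981 * 4 ^ (k + 6) := by
  rw [sum_range_blockIndex (fun j ↦ blockWeight (k + 6) j ^ 2)]
  have h0 : ∑ z ∈ range (4 ^ k), blockWeight (k + 6) (blockIndex z) ^ 2 ≤
      4 ^ k * (8 / 7) ^ 2 := by
    refine (sum_le_card_nsmul _ _ ((8 / 7 : ℝ) ^ 2) fun z _ ↦
      pow_le_pow_left₀ (blockWeight_nonneg _ _) (blockWeight_le _ _) 2).trans_eq ?_
    rw [card_range, nsmul_eq_mul]
    push_cast
    rfl
  have h1 : ∑ m ∈ range 11, 3 * 4 ^ (k + m) * blockWeight (k + 6) (k + m + 1) ^ 2 ≤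
      4 ^ k * (0.2981 * 4 ^ 6 - (8 / 7) ^ 2) := by
    have hw (m : ℕ) : blockWeight (k + 6) (k + m + 1) = blockWeight 6 (m + 1) := by
      simp only [blockWeight, Nat.add_le_add_iff_left, add_assoc, Nat.add_sub_add_left]
    simp only [pow_add, hw, mul_left_comm (3 : ℝ), mul_assoc, ← mul_sum]
    refine mul_le_mul_of_nonneg_left ?_ (by positivity)
    norm_num [sum_range_succ, blockWeight]
  rw [pow_add]
  linarith

end Blocks

/-! ### Charging edges to blocks and averaging. -/

section WeightedCount

open scoped Classical in
/-- The weighted number of edges at block `i`, scaled by `8 ^ (-i)`. -/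
noncomputable def weightedBlockDegree (G : SimpleGraph ℕ) (i : ℕ) : ℝ :=
  (1 / 8) ^ i * ∑ z ∈ range (4 ^ (i + 5)),
    blockWeight i (blockIndex z) * #((block i).filter (G.Adj z))

variable {G : SimpleGraph ℕ}

theorem weightedBlockDegree_add_six_le (hG : (completeBipartiteGraph (Fin 2) (Fin 2)).Free G)
    (k : ℕ) : weightedBlockDegree G (k + 6) ≤ 0.4095 + 1200 * (1 / 2) ^ (k + 6) := by
  classical
  have h := two_mul_sum_mul_card_le hG (block (k + 6)) (range (4 ^ (k + 6 + 5)))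
    -- $11/8$ approximates the optimal scale $\sqrt{(9/16)/0.2981}$.
    fun z ↦ 11 / 8 * 2 ^ (k + 6) * blockWeight (k + 6) (blockIndex z)
  have hcard : (#(block (k + 6)) : ℝ) = 3 / 4 * 4 ^ (k + 6) := by
    rw [card_block_succ, pow_succ]
    push_cast
    ring
  have hS := sum_sq_blockWeight_le k
  have hR : ∑ z ∈ range (4 ^ (k + 6 + 5)),
      (11 / 8 * 2 ^ (k + 6) * blockWeight (k + 6) (blockIndex z) + 1 / 2 : ℝ) ^ 2 ≤
      121 / 64 * 4 ^ (k + 6) * (0.2981 * 4 ^ (k + 6)) + 4 ^ (k + 11) * (3 * 2 ^ (k + 6)) := by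
    calc _ ≤ ∑ z ∈ range (4 ^ (k + 11)),
          (121 / 64 * 4 ^ (k + 6) * blockWeight (k + 6) (blockIndex z) ^ 2 + 3 * 2 ^ (k + 6)) := by
          refine sum_le_sum fun z _ ↦ ?_
          have h1 := blockWeight_le (k + 6) (blockIndex z)
          have h2 : (1 : ℝ) ≤ 2 ^ (k + 6) := one_le_pow₀ (by norm_num)
          have h3 : (4 : ℝ) ^ (k + 6) = (2 ^ (k + 6)) ^ 2 := by
            rw [← pow_mul, mul_comm, pow_mul]; norm_num
          rw [h3]
          nlinarith [mul_le_mul_of_nonneg_left h1 (zero_le_one.trans h2)]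
      _ ≤ _ := by
          rw [sum_add_distrib, ← mul_sum, sum_const, card_range, nsmul_eq_mul]
          push_cast
          gcongr
  simp only [mul_assoc, ← mul_sum] at h
  simp only [mul_assoc] at hR
  have hT : ∑ z ∈ range (4 ^ (k + 6 + 5)), blockWeight (k + 6) (blockIndex z) *
      #((block (k + 6)).filter (G.Adj z)) = 8 ^ (k + 6) * weightedBlockDegree G (k + 6) := by
    rw [weightedBlockDegree, ← mul_assoc, ← mul_pow]
    norm_num
  rw [hT, hcard] at h
  set t := weightedBlockDegree G (k + 6)
  set y : ℝ := 2 ^ (k + 6) with hy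
  have hy0 : 0 < y := by positivity
  have h4 : (4 : ℝ) ^ (k + 6) = y ^ 2 := by rw [hy, ← pow_mul, mul_comm, pow_mul]; norm_num
  have h8 : (8 : ℝ) ^ (k + 6) = y ^ 3 := by rw [hy, ← pow_mul, mul_comm, pow_mul]; norm_num
  have h11 : (4 : ℝ) ^ (k + 11) = 1024 * y ^ 2 := by rw [← h4]; ring
  have hh : ((1 : ℝ) / 2) ^ (k + 6) = 1 / y := by rw [hy, one_div_pow]
  rw [h4, h11] at hR
  rw [h4, h8] at h
  rw [hh]
  have hmain : 11 / 4 * y ^ 4 * t ≤ 11 / 4 * y ^ 4 * (0.4095 + 1200 * (1 / y)) := by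
    have : 11 / 4 * y ^ 4 * (0.4095 + 1200 * (1 / y)) = 1.126125 * y ^ 4 + 3300 * y ^ 3 := by
      field_simp
      ring
    rw [this]
    have : 0 < y ^ 3 := by positivity
    have : 0 < y ^ 4 := by positivity
    nlinarith
  exact le_of_mul_le_mul_left hmain (by positivity)

theorem exists_weightedBlockDegree_le
    (hG : (completeBipartiteGraph (Fin 2) (Fin 2)).Free G) :
    ∃ C : ℝ, ∀ i, weightedBlockDegree G i ≤ 0.4095 + C * (1 / 2) ^ i := by
  -- The factor $64=2^6$ offsets $(1/2)^i$ for $i<6$.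
  refine ⟨1200 + ∑ i ∈ range 6, 64 * |weightedBlockDegree G i|, fun i ↦ ?_⟩
  have hS : 0 ≤ ∑ i ∈ range 6, 64 * |weightedBlockDegree G i| := by positivity
  rcases lt_or_ge i 6 with hi | hi
  · have h1 : 64 * |weightedBlockDegree G i| ≤ ∑ i ∈ range 6, 64 * |weightedBlockDegree G i| :=
      single_le_sum (f := fun i ↦ 64 * |weightedBlockDegree G i|) (fun _ _ ↦ by positivity)
        (mem_range.2 hi)
    have h2 : (1 / 2 : ℝ) ^ 6 ≤ (1 / 2) ^ i :=
      pow_le_pow_of_le_one (by norm_num) (by norm_num) hi.le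
    have h3 := le_abs_self (weightedBlockDegree G i)
    norm_num at h2 ⊢
    nlinarith
  · obtain ⟨k, rfl⟩ := Nat.exists_eq_add_of_le' hi
    refine (weightedBlockDegree_add_six_le hG k).trans ?_
    gcongr
    linarith

theorem exists_sum_weightedBlockDegree_le
    (hG : (completeBipartiteGraph (Fin 2) (Fin 2)).Free G) :
    ∃ C : ℝ, ∀ n, ∑ i ∈ range n, weightedBlockDegree G i ≤ 0.4095 * n + C := by
  obtain ⟨C, hC⟩ := exists_weightedBlockDegree_le hG
  refine ⟨|C| * 2, fun n ↦ ?_⟩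
  calc ∑ i ∈ range n, weightedBlockDegree G i
      ≤ ∑ i ∈ range n, (0.4095 + |C| * (1 / 2) ^ i) := by
        refine sum_le_sum fun i _ ↦ (hC i).trans ?_
        gcongr
        exact le_abs_self C
    _ ≤ _ := by
        rw [sum_add_distrib, ← mul_sum, sum_const, card_range, nsmul_eq_mul, mul_comm (n : ℝ)]
        gcongr
        exact sum_geometric_two_le n

open scoped Classical in
theorem two_mul_initialEdges (G : SimpleGraph ℕ) (n : ℕ) :
    2 * (initialEdges G n : ℝ) =
      ∑ x ∈ range n, ∑ z ∈ range n, if G.Adj z x then (1 : ℝ) else 0 := by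
  have h := (G.induce (Set.Iio n)).sum_degrees_eq_twice_card_edges
  have hE : initialEdges G n = #(G.induce (Set.Iio n)).edgeFinset := by
    rw [initialEdges, ← coe_edgeFinset, Set.ncard_coe_finset]
  have hsub (f : ℕ → ℕ) : ∑ x ∈ range n, f x = ∑ x : Set.Iio n, f x :=
    (sum_subtype (range n) (p := (· ∈ Set.Iio n)) (by simp) f)
  have hN : 2 * initialEdges G n = ∑ x ∈ range n, ∑ z ∈ range n, if G.Adj z x then 1 else 0 := by
    rw [hE, ← h, hsub]
    refine sum_congr rfl fun x _ ↦ ?_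
    rw [hsub, ← card_neighborFinset_eq_degree, neighborFinset_eq_filter, card_filter]
    refine sum_congr rfl fun z _ ↦ ?_
    simp [G.adj_comm]
  exact_mod_cast hN

theorem sum_ite_le_pow_le (m n : ℕ) :
    ∑ l ∈ range n, (if m ≤ l then (1 / 8 : ℝ) ^ l else 0) ≤ 8 / 7 * (1 / 8) ^ m := by
  have h : ∑ l ∈ range n, (if m ≤ l then (1 / 8 : ℝ) ^ l else 0) =
      if m ≤ n then 8 / 7 * ((1 / 8) ^ m - (1 / 8) ^ n) else 0 := by
    induction n with
    | zero =>
      rcases m.eq_zero_or_pos with rfl | hm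
      · simp
      · simp [hm.ne']
    | succ n ih =>
      rw [sum_range_succ, ih]
      rcases lt_trichotomy m (n + 1) with hm | rfl | hm
      · rw [if_pos (by omega), if_pos (by omega), if_pos (by omega), pow_succ]
        ring
      · simp
      · rw [if_neg (by omega), if_neg (by omega), if_neg (by omega), add_zero]
  rw [h]
  have : (0 : ℝ) < (1 / 8) ^ m := by positivity
  have : (0 : ℝ) < (1 / 8) ^ n := by positivity
  split_ifs <;> linarith

open scoped Classical in
theorem sum_weightedBlockDegree_ge (G : SimpleGraph ℕ) (L : ℕ) :
    ∑ x ∈ range (4 ^ L), ∑ z ∈ range (4 ^ L), (if G.Adj z x then (1 : ℝ) else 0) *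
        (blockWeight (blockIndex x) (blockIndex z) * (1 / 8) ^ blockIndex x) ≤
      ∑ i ∈ range (L + 1), weightedBlockDegree G i := by
  rw [← sum_fiberwise_of_maps_to (s := range (4 ^ L)) (t := range (L + 1)) (g := blockIndex)
    fun x hx ↦ mem_range.2 (Nat.lt_succ_of_le (blockIndex_le_iff.2 (mem_range.1 hx)))]
  refine sum_le_sum fun i hi ↦ ?_
  have hblock : {x ∈ range (4 ^ L) | blockIndex x = i} = block i := by
    ext x
    simp only [mem_block, mem_filter, mem_range, and_iff_right_iff_imp]
    rintro rfl
    exact blockIndex_le_iff.1 (Nat.le_of_lt_succ (mem_range.1 hi))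
  rw [hblock, sum_comm]
  have hinner (z : ℕ) : ∑ x ∈ block i, (if G.Adj z x then (1 : ℝ) else 0) *
        (blockWeight (blockIndex x) (blockIndex z) * (1 / 8) ^ blockIndex x) =
      (1 / 8) ^ i * (blockWeight i (blockIndex z) * #((block i).filter (G.Adj z))) := by
    rw [card_filter, Nat.cast_sum, mul_sum, mul_sum]
    refine sum_congr rfl fun x hx ↦ ?_
    rw [mem_block.1 hx]
    push_cast
    ring
  simp only [hinner]
  rw [weightedBlockDegree, mul_sum]
  -- Vertices from $4^{i+5}$ on have weight $0$ for block $i$.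
  rw [← sum_filter_of_ne (p := (· < 4 ^ (i + 5)))]
  · refine sum_le_sum_of_subset_of_nonneg (fun z hz ↦ mem_range.2 (mem_filter.1 hz).2) ?_
    intro z _ _
    have := blockWeight_nonneg i (blockIndex z)
    positivity
  · intro z _ hz
    contrapose! hz
    rw [blockWeight_eq_zero]
    · ring
    · by_contra! h
      exact hz.not_gt (blockIndex_le_iff.1 h)

theorem sum_initialEdges_le (G : SimpleGraph ℕ) (L : ℕ) :
    ∑ l ∈ range (L + 1), (1 / 8 : ℝ) ^ l * initialEdges G (4 ^ l) ≤
      ∑ i ∈ range (L + 1), weightedBlockDegree G i := by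
  classical
  refine le_trans ?_ (sum_weightedBlockDegree_ge G L)
  set a : ℕ → ℕ → ℝ := fun x z ↦ if G.Adj z x then 1 else 0 with ha
  have ha0 (x z : ℕ) : 0 ≤ a x z := by simp only [ha]; split_ifs <;> norm_num
  have hasymm (x z : ℕ) : a x z = a z x := by simp only [ha, G.adj_comm]
  set θ : ℕ → ℕ → ℝ := fun x z ↦
    blockWeight (blockIndex x) (blockIndex z) * (1 / 8) ^ blockIndex x with hθ
  change _ ≤ ∑ x ∈ range (4 ^ L), ∑ z ∈ range (4 ^ L), a x z * θ x z
  have hsymm : 2 * ∑ x ∈ range (4 ^ L), ∑ z ∈ range (4 ^ L), a x z * θ x z =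
      ∑ x ∈ range (4 ^ L), ∑ z ∈ range (4 ^ L),
        a x z * (8 / 7 * (1 / 8) ^ max (blockIndex x) (blockIndex z)) := by
    rw [two_mul]
    -- Swapping the ends in one copy pairs the two shares of each edge.
    nth_rewrite 2 [sum_comm]
    simp only [← sum_add_distrib]
    refine sum_congr rfl fun x _ ↦ sum_congr rfl fun z _ ↦ ?_
    rw [hasymm z x, ← mul_add, ← blockWeight_symm_sum]
  have hedges (l : ℕ) (hl : l ∈ range (L + 1)) : 2 * ((1 / 8 : ℝ) ^ l * initialEdges G (4 ^ l)) =
      ∑ x ∈ range (4 ^ L), ∑ z ∈ range (4 ^ L),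
        a x z * (if max (blockIndex x) (blockIndex z) ≤ l then (1 / 8) ^ l else 0) := by
    have hfilter : range (4 ^ l) = {x ∈ range (4 ^ L) | blockIndex x ≤ l} := by
      ext x
      simp only [mem_filter, mem_range, blockIndex_le_iff]
      have : 4 ^ l ≤ 4 ^ L :=
        Nat.pow_le_pow_right (by norm_num) (Nat.le_of_lt_succ (mem_range.1 hl))
      omega
    rw [mul_left_comm, two_mul_initialEdges, hfilter, sum_filter, mul_sum]
    refine sum_congr rfl fun x _ ↦ ?_
    split_ifs with hx
    · rw [sum_filter, mul_sum]
      refine sum_congr rfl fun z _ ↦ ?_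
      by_cases hz : blockIndex z ≤ l <;> simp [hx, hz, ha]
    · simp [hx]
  have hmain : 2 * ∑ l ∈ range (L + 1), (1 / 8 : ℝ) ^ l * initialEdges G (4 ^ l) ≤
      2 * ∑ x ∈ range (4 ^ L), ∑ z ∈ range (4 ^ L), a x z * θ x z := by
    rw [hsymm, mul_sum, sum_congr rfl hedges, sum_comm]
    refine sum_le_sum fun x _ ↦ ?_
    rw [sum_comm]
    refine sum_le_sum fun z _ ↦ ?_
    rw [← mul_sum]
    exact mul_le_mul_of_nonneg_left (sum_ite_le_pow_le _ _) (ha0 x z)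
  linarith

theorem not_eventually_lt_initialEdges (hG : (completeBipartiteGraph (Fin 2) (Fin 2)).Free G) :
    ¬ ∀ᶠ n : ℕ in Filter.atTop, 0.41 < (initialEdges G n : ℝ) / (n : ℝ) ^ (3 / 2 : ℝ) := by
  intro h
  have hpow : Filter.Tendsto (fun l : ℕ ↦ 4 ^ l) Filter.atTop Filter.atTop :=
    tendsto_pow_atTop_atTop_of_one_lt (by norm_num)
  obtain ⟨l₀, hl₀⟩ := Filter.eventually_atTop.1 (hpow.eventually h)
  have hl (l : ℕ) (hl : l₀ ≤ l) : 0.41 ≤ (1 / 8 : ℝ) ^ l * initialEdges G (4 ^ l) := by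
    have h1 := (hl₀ l hl).le
    have h2 : ((4 ^ l : ℕ) : ℝ) ^ (3 / 2 : ℝ) = 8 ^ l := by
      push_cast
      rw [← Real.rpow_natCast, ← Real.rpow_mul (by norm_num), mul_comm, Real.rpow_mul (by norm_num),
        Real.rpow_natCast]
      congr 1
      rw [show (4 : ℝ) = 2 ^ (2 : ℝ) by norm_num, ← Real.rpow_mul (by norm_num)]
      norm_num
    rw [h2, div_eq_inv_mul] at h1
    rwa [one_div_pow, one_div]
  obtain ⟨C, hC⟩ := exists_sum_weightedBlockDegree_le hG
  have hlower (L : ℕ) : 0.41 * ((L : ℝ) - l₀) ≤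
      ∑ l ∈ range L, (1 / 8 : ℝ) ^ l * initialEdges G (4 ^ l) := by
    induction L with
    | zero =>
      rw [sum_range_zero, Nat.cast_zero, zero_sub, mul_neg, neg_nonpos]
      positivity
    | succ L ih =>
      rw [sum_range_succ]
      rcases le_or_gt l₀ L with h | h
      · have := hl L h
        push_cast
        linarith
      · have h1 : ((L + 1 : ℕ) : ℝ) ≤ l₀ := by exact_mod_cast h
        have h2 : 0 ≤ ∑ l ∈ range L, (1 / 8 : ℝ) ^ l * initialEdges G (4 ^ l) := by positivity
        have h3 : 0 ≤ (1 / 8 : ℝ) ^ L * initialEdges G (4 ^ L) := by positivity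
        linarith
  -- $2000=1/(0.41-0.4095)$.
  obtain ⟨L, hL⟩ := exists_nat_gt (2000 * (0.41 * l₀ + C))
  have h1 := (hlower (L + 1)).trans ((sum_initialEdges_le G L).trans (hC (L + 1)))
  push_cast at h1
  linarith

end WeightedCount

theorem theorem2 :
    IsTuranExponent (completeBipartiteGraph (Fin 2) (Fin 2)) (3 / 2) ∧
      infiniteTuranNumber (completeBipartiteGraph (Fin 2) (Fin 2)) ≤ ((0.41 : ℝ) : EReal) := by
  refine ⟨isTuranExponent_two_two, iSup_le fun ⟨G, hG⟩ ↦ ?_⟩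
  by_contra! hlt
  refine not_eventually_lt_initialEdges hG ?_
  filter_upwards [Filter.eventually_lt_of_lt_liminf hlt] with n hn
  rw [isTuranExponent_two_two.turanExponent_eq] at hn
  exact EReal.coe_lt_coe_iff.1 hn
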